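/- Let \(G\) be a finite connected simple triangle-free graph on \(n\) vertices with minimum degree \(\delta(G)\ge 3\) and \(\xi_3(G)\ge n+1\). Then \[\mathrm{sn}(G)=\mathrm{gon}(G)=n-\alpha_2^c(G).\] Here the following notation is used. A non-empty set \(S\subseteq V(G)\) is connected if the induced subgraph \(G[S]\) is connected, and \(E(A,B)\) is the set of edges with one end in \(A\) and the other in \(B\). - \(\xi_3(G)\) is the minimum of \(|E(S,S^C)|\) over all connected sets \(S\) of exactly \(3\) vertices. - \(\alpha_2^c(G)\) is the maximum size of a set \(S\subseteq V(G)\) such that every connected component of \(G[S]\) has at most \(2\) vertices. - A scramble \(\mathcal S\) on \(G\) is a collection of connected subsets of \(V(G)\), called eggs. Let \(h(\mathcal S)\) be the minimum size of a set of vertices meeting every egg, and let \(e(\mathcal S)\) be the minimum of \(|E(A,A^C)|\) over all \(A\subseteq V(G)\) such that \(A\) and \(A^C\) each contain an egg (\(e(\mathcal S)=\infty\) if there is no such \(A\)). The scramble number \(\mathrm{sn}(G)\) is the maximum of \(\min(h(\mathcal S),e(\mathcal S))\) over all scrambles \(\mathcal S\) on \(G\). - A divisor on \(G\) is a function \(D:V(G)\to\mathbb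 Z\), of degree \(\sum_v D(v)\); it is effective if \(D\ge 0\). Chip-firing at \(v\) lowers \(D(v)\) by the degree of \(v\) and raises \(D(w)\) by \(1\) for each neighbour \(w\) of \(v\); two divisors are equivalent if a finite sequence of chip-firing moves transforms one into the other. The rank of \(D\) is \(-1\) if \(D\) is not equivalent to an effective divisor, and otherwise the largest integer \(r\ge 0\) such that \(D-E\) is equivalent to an effective divisor for every effective divisor \(E\) of degree \(r\). The gonality \(\mathrm{gon}(G)\) is the minimum degree of a divisor of positive rank. -/

import Mathlib

namespace GraphGonality

section Parameters

variable {V : Type*} [Fintype V] [DecidableEq V]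

/-- A set `S` of vertices is connected if the induced subgraph `G[S]` is connected
(in particular `S` is non-empty). -/
def IsConnectedSet (G : SimpleGraph V) (S : Finset V) : Prop :=
  (G.induce (S : Set V)).Connected

/-- The outdegree `|E(S, Sᶜ)|` of a set of vertices. As `S` and `Sᶜ` are disjoint, the adjacent
pairs in `S × Sᶜ` correspond bijectively to the edges between `S` and `Sᶜ`. -/
def outdegree (G : SimpleGraph V) [DecidableRel G.Adj] (S : Finset V) : ℕ :=
  (G.interedges S Sᶜ).card

/-- `ξ_k(G)`: the minimum outdegree of a connected subgraph on `k` vertices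
(`⊤` if there is no such subgraph). -/
noncomputable def xi (G : SimpleGraph V) [DecidableRel G.Adj] (k : ℕ) : ℕ∞ :=
  ⨅ (S : Finset V) (_ : IsConnectedSet G S ∧ S.card = k), (outdegree G S : ℕ∞)

/-- `S` is an `ℓ`-component independent set: all components of `G[S]` have order at most `ℓ`. -/
def IsComponentIndependent (G : SimpleGraph V) (l : ℕ) (S : Finset V) : Prop :=
  ∀ c : (G.induce (S : Set V)).ConnectedComponent, c.supp.ncard ≤ l

open Classical in
/-- `α^c_ℓ(G)`: the maximum size of an `ℓ`-component independent set. -/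
noncomputable def componentIndepNum (G : SimpleGraph V) (l : ℕ) : ℕ :=
  ({S : Finset V | IsComponentIndependent G l S} : Finset (Finset V)).sup Finset.card

end Parameters

section Scrambles

variable {V : Type*} [Fintype V] [DecidableEq V]

/-- A scramble on `G`: a collection of connected vertex sets, called eggs. -/
structure Scramble (G : SimpleGraph V) where
  /-- The eggs of the scramble. -/
  eggs : Finset (Finset V)
  /-- Every egg is connected. -/
  connected : ∀ E ∈ eggs, IsConnectedSet G E

/-- `C` meets every egg. -/
def Scramble.IsHittingSet {G : SimpleGraph V} (S : Scramble G) (C : Finset V) : Prop :=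
  ∀ E ∈ S.eggs, (C ∩ E).Nonempty

/-- `A` and its complement each contain an egg. -/
def Scramble.IsEggCut {G : SimpleGraph V} (S : Scramble G) (A : Finset V) : Prop :=
  (∃ E ∈ S.eggs, E ⊆ A) ∧ (∃ E ∈ S.eggs, E ⊆ Aᶜ)

/-- `h(S)`: the minimum size of a hitting set. -/
noncomputable def Scramble.hittingNumber {G : SimpleGraph V} (S : Scramble G) : ℕ∞ :=
  ⨅ (C : Finset V) (_ : S.IsHittingSet C), (C.card : ℕ∞)

/-- `e(S)`: the minimum size of an egg-cut (`⊤` if there is no egg-cut). -/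
noncomputable def Scramble.eggCutNumber {G : SimpleGraph V} [DecidableRel G.Adj]
    (S : Scramble G) : ℕ∞ :=
  ⨅ (A : Finset V) (_ : S.IsEggCut A), (outdegree G A : ℕ∞)

/-- The order of a scramble, `min (h(S), e(S))`. -/
noncomputable def Scramble.order {G : SimpleGraph V} [DecidableRel G.Adj]
    (S : Scramble G) : ℕ∞ :=
  min S.hittingNumber S.eggCutNumber

/-- `sn(G)`: the maximum order of a scramble on `G`. -/
noncomputable def scrambleNumber (G : SimpleGraph V) [DecidableRel G.Adj] : ℕ∞ :=
  ⨆ S : Scramble G, S.order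

end Scrambles

section Divisors

variable {V : Type*} [Fintype V] [DecidableEq V]

/-- The degree of a divisor; a divisor is a function `D : V → ℤ`. -/
def divisorDegree (D : V → ℤ) : ℤ := ∑ v, D v

/-- The chip-firing move at `v`. -/
def chipFire (G : SimpleGraph V) [DecidableRel G.Adj] (v : V) (D : V → ℤ) : V → ℤ :=
  fun w => if w = v then D v - G.degree v else D w + (if G.Adj v w then 1 else 0)

/-- `D ∼ D'`: `D` can be transformed into `D'` by a finite sequence of chip-firing moves. -/
def DivisorEquiv (G : SimpleGraph V) [DecidableRel G.Adj] : (V → ℤ) → (V → ℤ) → Prop :=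
  Relation.ReflTransGen (fun D D' => ∃ v, D' = chipFire G v D)

/-- A divisor is effective if all its coefficients are nonnegative. -/
def IsEffective (D : V → ℤ) : Prop := ∀ v, 0 ≤ D v

/-- `D` is equivalent to some effective divisor. -/
def EquivEffective (G : SimpleGraph V) [DecidableRel G.Adj] (D : V → ℤ) : Prop :=
  ∃ D', IsEffective D' ∧ DivisorEquiv G D D'

open Classical in
/-- The rank of a divisor: `-1` if `D` is not equivalent to an effective divisor, and otherwise
the maximum `r ≥ 0` such that `D - E` is equivalent to an effective divisor for every effective
`E` of degree `r`. (As degree is preserved by chip-firing, such `r` are at most `deg D`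
when `V` is non-empty, so the supremum is a maximum.) -/
noncomputable def rank (G : SimpleGraph V) [DecidableRel G.Adj] (D : V → ℤ) : ℤ :=
  if EquivEffective G D then
    ((sSup {r : ℕ | ∀ E : V → ℤ, IsEffective E → divisorDegree E = r →
      EquivEffective G (D - E)} : ℕ) : ℤ)
  else -1

/-- `gon(G)`: the minimum degree of a divisor of positive rank. (Such divisors are equivalent to
effective ones, so their degrees are natural numbers; they exist when `V` is non-empty.) -/
noncomputable def gonality (G : SimpleGraph V) [DecidableRel G.Adj] : ℕ :=
  sInf {d : ℕ | ∃ D : V → ℤ, divisorDegree D = d ∧ 0 < rank G D}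

end Divisors

end GraphGonality

/-!
The chain of inequalities `n - α ≤ sn(G) ≤ gon(G) ≤ n - α` is proved, where `n` is the number of
vertices and `α = α₂ᶜ(G)`.

*Upper bound* (`rank_indicator_compl_pos`). Let `S` be a set of `α` vertices whose components have
at most two vertices. One chip on each vertex outside `S` has positive rank: firing the complement
of a component of `G[S]` moves chips onto that component, and costs each outside vertex at most one
chip because `G` has no triangles.

*Scramble number against gonality* (`Scramble.order_le_of_rank_pos`). This holds for every graph.
Among the effective divisors equivalent to one of positive rank, take `D` hitting an
inclusion-maximal family of eggs. If some egg `E` is missed, move `D` to a divisor hitting `E` by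
firing, again and again, the set `U` where the remaining script is maximal. By maximality of `D`,
some egg must be vacated before or when `E` is hit; at that moment the vacated egg lies in `U`
and `E` in its complement, so `U` is an egg-cut, and the chips fired along its edges number at most
`deg D` (`exists_eggCut_of_maximal`).

*Lower bound*. Take as eggs all connected sets of three vertices. A set hits all of them exactly
when its complement has components of at most two vertices, so the hitting number is `n - α`. For
the egg-cuts, let `A` be the side with at most `n / 2` vertices. If each of its vertices has two
neighbours outside, then `A` sends out at least `ξ₃ ≥ n + 1` edges (`outdegree_le_of_two_le`).
Otherwise double counting at the neighbourhood of a vertex with at most one neighbour outside, and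
of a suitable neighbour of it, gives at least `n - Δ ≥ n - α` edges
(`card_le_outdegree_add_componentIndepNum`). Here `ξ₃ ≥ n + 1` is used in the form that the degrees
on a path of three vertices sum to at least `n + 5`, and the absence of triangles in the form that
adjacent vertices have disjoint neighbourhoods.
-/

namespace GraphGonality

open Finset

/-! ### Edge counts and connected sets -/

/-- If a connected set `E` meets `U` and no edge of `G[E]` leaves `U`, then `E ⊆ U`. -/
theorem IsConnectedSet.subset_of_no_boundary {V : Type*} {G : SimpleGraph V} {E U : Finset V}
    (hE : IsConnectedSet G E) {x : V} (hxE : x ∈ E) (hxU : x ∈ U)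
    (h : ∀ u ∈ E, ∀ w ∈ E, u ∈ U → w ∉ U → ¬ G.Adj u w) : E ⊆ U := by
  intro y hy
  by_contra hyU
  obtain ⟨p⟩ := hE.preconnected ⟨x, hxE⟩ ⟨y, hy⟩
  obtain ⟨d, -, h1, h2⟩ := p.exists_boundary_dart {z | (z : V) ∈ U} hxU hyU
  exact h _ d.fst.2 _ d.snd.2 h1 h2 (SimpleGraph.comap_adj.1 d.adj)

theorem isConnectedSet_path {V : Type*} [DecidableEq V] {G : SimpleGraph V} {a b c : V}
    (hab : G.Adj a b) (hbc : G.Adj b c) : IsConnectedSet G {a, b, c} := by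
  have h := SimpleGraph.induce_union_connected
    (SimpleGraph.induce_pair_connected_of_adj hab).preconnected
    (SimpleGraph.induce_pair_connected_of_adj hbc).preconnected ⟨b, by simp⟩
  have e : ((({a, b, c} : Finset V)) : Set V) = {a, b} ∪ {b, c} := by
    ext z; simp; tauto
  rw [IsConnectedSet, e]
  exact h

theorem IsConnectedSet.exists_adj {V : Type*} {G : SimpleGraph V} {P : Finset V}
    (hP : IsConnectedSet G P) (hc : 1 < #P) : ∃ u ∈ P, ∃ w ∈ P, G.Adj u w := by
  obtain ⟨u, hu, w, hw, hne⟩ := one_lt_card.1 hc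
  have : Nontrivial (P : Set V) := ⟨⟨u, hu⟩, ⟨w, hw⟩, by simpa using hne⟩
  obtain ⟨z, hz⟩ := hP.preconnected.exists_adj_of_nontrivial ⟨u, hu⟩
  exact ⟨u, hu, z, z.2, SimpleGraph.comap_adj.1 hz⟩

variable {V : Type*} [Fintype V] [DecidableEq V]

theorem outdegree_eq_sum (G : SimpleGraph V) [DecidableRel G.Adj] (A : Finset V) :
    outdegree G A = ∑ x ∈ A, #(G.neighborFinset x \ A) := by
  rw [outdegree, SimpleGraph.interedges_def, card_filter, sum_product]
  refine sum_congr rfl fun x _ => ?_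
  rw [← card_filter]
  congr 1
  ext y
  simp [and_comm]

theorem outdegree_compl (G : SimpleGraph V) [DecidableRel G.Adj] (A : Finset V) :
    outdegree G Aᶜ = outdegree G A := by
  rw [outdegree, outdegree, compl_compl]
  have := G.symm
  exact Rel.card_interedges_comm _ _

/-! ### Divisors and firing scripts -/

/-- `D` and `D'` differ by a firing script: firing each vertex `v` exactly `f v` times turns `D`
into `D - L f`, where `L` is the Laplacian. Negative values of `f` are allowed; this does not
enlarge the class of `D`, as constant scripts change nothing. -/
def LapEquiv (G : SimpleGraph V) [DecidableRel G.Adj] (D D' : V → ℤ) : Prop :=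
  ∃ f : V → ℤ, D' = D - (G.lapMatrix ℤ).mulVec f

section Divisors

variable {G : SimpleGraph V} [DecidableRel G.Adj]

theorem lapMatrix_mulVec_apply_sub (f : V → ℤ) (v : V) :
    (G.lapMatrix ℤ).mulVec f v = ∑ u ∈ G.neighborFinset v, (f v - f u) := by
  rw [SimpleGraph.lapMatrix_mulVec_apply, sum_sub_distrib, sum_const,
    SimpleGraph.card_neighborFinset_eq_degree, nsmul_eq_mul]

theorem lapMatrix_mulVec_const (c : ℤ) :
    (G.lapMatrix ℤ).mulVec (fun _ => c) = 0 := by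
  ext v
  simp [lapMatrix_mulVec_apply_sub]

theorem lapMatrix_mulVec_indicator_of_mem {U : Finset V} {v : V} (hv : v ∈ U) :
    (G.lapMatrix ℤ).mulVec (fun w => if w ∈ U then 1 else 0) v
      = #(G.neighborFinset v \ U) := by
  rw [lapMatrix_mulVec_apply_sub, ← filter_notMem_eq_sdiff, card_filter]
  push_cast
  refine sum_congr rfl fun u _ => ?_
  by_cases h : u ∈ U <;> simp [h, hv]

theorem lapMatrix_mulVec_indicator_of_notMem {U : Finset V} {v : V} (hv : v ∉ U) :
    (G.lapMatrix ℤ).mulVec (fun w => if w ∈ U then 1 else 0) v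
      = -#(G.neighborFinset v ∩ U) := by
  rw [lapMatrix_mulVec_apply_sub, ← filter_mem_eq_inter, card_filter]
  push_cast
  rw [← sum_neg_distrib]
  refine sum_congr rfl fun u _ => ?_
  by_cases h : u ∈ U <;> simp [h, hv]

theorem chipFire_eq (v : V) (D : V → ℤ) :
    chipFire G v D = D - (G.lapMatrix ℤ).mulVec (Pi.single v 1) := by
  ext w
  rw [chipFire, Pi.sub_apply, SimpleGraph.lapMatrix_mulVec_apply]
  have : ∑ u ∈ G.neighborFinset w, (Pi.single v (1 : ℤ) : V → ℤ) u
      = if G.Adj v w then 1 else 0 := by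
    simp [Pi.single_apply, sum_ite_eq', G.adj_comm]
  rw [this]
  by_cases h : w = v
  · subst h; simp
  · simp [h]

theorem divisorEquiv_sub_nat (f : V → ℕ) (D : V → ℤ) :
    DivisorEquiv G D (D - (G.lapMatrix ℤ).mulVec (fun v => (f v : ℤ))) := by
  induction hn : ∑ v, f v generalizing f D with
  | zero =>
    have h0 : (fun v => (f v : ℤ)) = 0 := by
      ext v
      have := (sum_eq_zero_iff.1 hn) v (mem_univ v)
      simpa using this
    rw [h0, Matrix.mulVec_zero, sub_zero]
    exact Relation.ReflTransGen.refl
  | succ n ih =>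
    obtain ⟨v, -, hv⟩ : ∃ v ∈ univ, f v ≠ 0 := by
      by_contra! h
      rw [sum_eq_zero h] at hn
      omega
    have hf : (fun w => (f w : ℤ))
        = (fun w => ((Function.update f v (f v - 1) w : ℕ) : ℤ)) + Pi.single v 1 := by
      ext w
      by_cases h : w = v
      · subst h; simp; omega
      · simp [h]
    have hs : ∑ w, Function.update f v (f v - 1) w = n := by
      have h1 := add_sum_erase univ f (mem_univ v)
      have h2 := add_sum_erase univ (Function.update f v (f v - 1)) (mem_univ v)
      have h3 : ∑ x ∈ univ.erase v, Function.update f v (f v - 1) x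
          = ∑ x ∈ univ.erase v, f x :=
        sum_congr rfl fun x hx => Function.update_of_ne (ne_of_mem_erase hx) _ _
      rw [Function.update_self] at h2
      omega
    have := ih _ (chipFire G v D) hs
    rw [chipFire_eq, sub_sub, ← Matrix.mulVec_add, add_comm, ← hf] at this
    exact Relation.ReflTransGen.head ⟨v, (chipFire_eq v D).symm⟩ this

/-- Adding a constant makes a script nonnegative without changing its effect. -/
theorem exists_nat_script_eq (f : V → ℤ) :
    ∃ g : V → ℕ, (G.lapMatrix ℤ).mulVec (fun v => (g v : ℤ)) = (G.lapMatrix ℤ).mulVec f := by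
  let M : ℤ := ∑ v, |f v|
  have hM : ∀ v, 0 ≤ f v + M := fun v => by
    have h1 : |f v| ≤ M :=
      single_le_sum (f := fun v => |f v|) (fun i _ => abs_nonneg _) (mem_univ v)
    have h2 := neg_abs_le (f v)
    linarith
  refine ⟨fun v => (f v + M).toNat, ?_⟩
  have e : (fun v => (((f v + M).toNat : ℕ) : ℤ)) = f + fun _ => M := by
    ext v
    simp [hM v]
  rw [e, Matrix.mulVec_add, lapMatrix_mulVec_const, add_zero]

theorem divisorEquiv_iff {D D' : V → ℤ} : DivisorEquiv G D D' ↔ LapEquiv G D D' := by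
  constructor
  · intro h
    induction h with
    | refl => exact ⟨0, by simp⟩
    | tail _ h ih =>
      obtain ⟨f, rfl⟩ := ih
      obtain ⟨v, rfl⟩ := h
      exact ⟨f + Pi.single v 1, by rw [chipFire_eq, Matrix.mulVec_add, sub_sub]⟩
  · rintro ⟨f, rfl⟩
    obtain ⟨g, hg⟩ := exists_nat_script_eq (G := G) f
    exact hg ▸ divisorEquiv_sub_nat g D

theorem LapEquiv.degree_eq {D D' : V → ℤ} (h : LapEquiv G D D') :
    divisorDegree D' = divisorDegree D := by
  obtain ⟨f, rfl⟩ := h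
  simp only [divisorDegree, Pi.sub_apply, sum_sub_distrib, sub_eq_self]
  have h1 := Matrix.dotProduct_mulVec (1 : V → ℤ) (G.lapMatrix ℤ) f
  rw [← Matrix.mulVec_transpose, (G.isSymm_lapMatrix (R := ℤ)).eq,
    show (1 : V → ℤ) = fun _ => 1 from rfl, lapMatrix_mulVec_const, zero_dotProduct] at h1
  simpa [dotProduct] using h1

/-- Any two members of the class of `D` are joined by a script with natural values. -/
theorem LapEquiv.exists_nat_script {D D' D'' : V → ℤ} (h' : LapEquiv G D D')
    (h'' : LapEquiv G D D'') :
    ∃ f : V → ℕ, D'' = D' - (G.lapMatrix ℤ).mulVec (fun v => (f v : ℤ)) := by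
  obtain ⟨f, rfl⟩ := h'
  obtain ⟨g, rfl⟩ := h''
  obtain ⟨k, hk⟩ := exists_nat_script_eq (G := G) (g - f)
  refine ⟨k, ?_⟩
  rw [hk, Matrix.mulVec_sub]
  abel

theorem LapEquiv.sub_script {D D' : V → ℤ} (h : LapEquiv G D D') (f : V → ℤ) :
    LapEquiv G D (D' - (G.lapMatrix ℤ).mulVec f) := by
  obtain ⟨g, rfl⟩ := h
  exact ⟨g + f, by rw [Matrix.mulVec_add, sub_sub]⟩

theorem exists_pos_of_rank_pos {D : V → ℤ} (h : 0 < rank G D) (v : V) :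
    ∃ D', IsEffective D' ∧ LapEquiv G D D' ∧ 0 < D' v := by
  unfold rank at h
  split_ifs at h with he
  · have h0 := Nat.pos_of_ne_zero (by exact_mod_cast h.ne')
    set s := {r : ℕ | ∀ E : V → ℤ, IsEffective E → divisorDegree E = r →
      EquivEffective G (D - E)} with hs
    obtain ⟨r, hr, hr0⟩ : ∃ r ∈ s, 0 < r := by
      by_contra! hcon
      have : sSup s ≤ 0 := csSup_le' fun r hr => hcon r hr
      omega
    obtain ⟨D', hD', hequiv⟩ := hr (Pi.single v (r : ℤ))
      (fun w => by by_cases hw : w = v <;> simp [hw])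
      (by simp [divisorDegree])
    obtain ⟨f, rfl⟩ := divisorEquiv_iff.1 hequiv
    refine ⟨D - (G.lapMatrix ℤ).mulVec f, fun w => ?_, ⟨f, rfl⟩, ?_⟩
    · have := hD' w
      by_cases hw : w = v <;> simp [hw] at this ⊢ <;> omega
    · have := hD' v
      simp at this ⊢
      omega
  · omega

theorem rank_pos_of_exists_pos [Nonempty V] {D : V → ℤ} (hD : IsEffective D)
    (h : ∀ v, ∃ D', IsEffective D' ∧ LapEquiv G D D' ∧ 0 < D' v) : 0 < rank G D := by
  unfold rank
  rw [if_pos ⟨D, hD, Relation.ReflTransGen.refl⟩]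
  obtain ⟨v₀⟩ := ‹Nonempty V›
  refine Int.natCast_pos.2 (lt_of_lt_of_le Nat.one_pos (le_csSup ?_ ?_))
  · -- degree is invariant, so no `r` beyond the degree of `D` qualifies
    refine ⟨(divisorDegree D).toNat, fun r hr => ?_⟩
    obtain ⟨D', hD', hequiv⟩ := hr (Pi.single v₀ (r : ℤ))
      (fun w => by by_cases hw : w = v₀ <;> simp [hw])
      (by simp [divisorDegree])
    have h1 := (divisorEquiv_iff.1 hequiv).degree_eq
    have h2 : 0 ≤ divisorDegree D' := sum_nonneg fun w _ => hD' w
    have h3 : divisorDegree (D - Pi.single v₀ (r : ℤ)) = divisorDegree D - r := by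
      simp [divisorDegree]
    omega
  · intro E hE hdeg
    obtain ⟨v, -, hv⟩ : ∃ v ∈ univ, E v ≠ 0 := by
      by_contra! hcon
      rw [divisorDegree, sum_eq_zero hcon] at hdeg
      simp at hdeg
    have hv1 : 1 ≤ E v := by have := hE v; omega
    have hzero : ∀ w, w ≠ v → E w = 0 := fun w hw => by
      have h1 := add_sum_erase univ E (mem_univ v)
      have h2 := single_le_sum (f := E) (fun i _ => hE i) (mem_erase.2 ⟨hw, mem_univ w⟩)
      have h3 := hE w
      simp only [divisorDegree, Nat.cast_one] at hdeg
      omega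
    have hE1 : E v = 1 := by
      have h1 := single_le_sum (f := E) (fun i _ => hE i) (mem_univ v)
      simp only [divisorDegree, Nat.cast_one] at hdeg
      omega
    obtain ⟨D', hD', ⟨f, rfl⟩, hpos⟩ := h v
    refine ⟨D - E - (G.lapMatrix ℤ).mulVec f, fun w => ?_, divisorEquiv_iff.2 ⟨f, rfl⟩⟩
    have := hD' w
    by_cases hw : w = v
    · subst hw
      simp only [Pi.sub_apply] at this hpos ⊢
      omega
    · have := hzero w hw
      simp only [Pi.sub_apply] at *
      omega

end Divisors

/-! ### The scramble number is at most the gonality -/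

section ScrambleGonality

variable {G : SimpleGraph V} [DecidableRel G.Adj]

/-- The eggs of `S` that contain a chip of `D`. -/
def Scramble.hitEggs (S : Scramble G) (D : V → ℤ) : Finset (Finset V) :=
  S.eggs.filter fun E => ∃ v ∈ E, 0 < D v

/-- Firing the set where a script attains its maximum keeps an effective divisor effective when
the whole script does. -/
theorem isEffective_fire_max {D : V → ℤ} (hD : IsEffective D) {f : V → ℤ} {M : ℤ}
    (hM : ∀ v, f v ≤ M) (hf : IsEffective (D - (G.lapMatrix ℤ).mulVec f)) {U : Finset V}
    (hU : ∀ v, v ∈ U ↔ f v = M) :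
    IsEffective (D - (G.lapMatrix ℤ).mulVec (fun w => if w ∈ U then 1 else 0)) := by
  intro v
  rw [Pi.sub_apply]
  by_cases hv : v ∈ U
  · refine (hf v).trans ?_
    rw [Pi.sub_apply, lapMatrix_mulVec_apply_sub, lapMatrix_mulVec_apply_sub]
    refine sub_le_sub_left (sum_le_sum fun u _ => ?_) _
    have h1 := hM u
    have h2 := (hU v).1 hv
    have h3 := hU u
    rw [if_pos hv]
    split_ifs with hu
    · omega
    · have : f u ≠ M := fun h => hu (h3.2 h)
      omega
  · rw [lapMatrix_mulVec_indicator_of_notMem hv]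
    have := hD v
    omega

/-- If the effective divisor `D` can fire `U`, it has a chip for every edge leaving `U`. -/
theorem outdegree_le_degree {D : V → ℤ} (hD : IsEffective D) {U : Finset V}
    (hfire : IsEffective (D - (G.lapMatrix ℤ).mulVec (fun w => if w ∈ U then 1 else 0))) :
    (outdegree G U : ℤ) ≤ divisorDegree D := by
  rw [outdegree_eq_sum, divisorDegree]
  push_cast
  refine le_trans (sum_le_sum fun v hv => ?_)
    (sum_le_sum_of_subset_of_nonneg (subset_univ U) fun v _ _ => hD v)
  have := hfire v
  rw [Pi.sub_apply, lapMatrix_mulVec_indicator_of_mem hv] at this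
  omega

/-- Let `D` be an effective divisor whose set of hit eggs is maximal within its class. If `D`
misses an egg which an equivalent effective divisor hits, then moving from one to the other by
firing level sets must at some point vacate an egg, and the level set fired then is an
egg-cut with at most `deg D` edges. -/
theorem exists_eggCut_of_maximal (S : Scramble G) {D₀ : V → ℤ} (T : Finset (Finset V))
    (hmax : ∀ D, IsEffective D → LapEquiv G D₀ D → T ⊆ S.hitEggs D → S.hitEggs D ⊆ T)
    {E : Finset V} (hE : E ∈ S.eggs) (hET : E ∉ T) (f : V → ℕ) (D : V → ℤ)
    (hD : IsEffective D) (hequiv : LapEquiv G D₀ D) (hT : S.hitEggs D = T)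
    (hf : IsEffective (D - (G.lapMatrix ℤ).mulVec (fun v => (f v : ℤ))))
    {w₀ : V} (hw₀ : w₀ ∈ E) (hpos : 0 < (D - (G.lapMatrix ℤ).mulVec (fun v => (f v : ℤ))) w₀) :
    ∃ U, S.IsEggCut U ∧ (outdegree G U : ℤ) ≤ divisorDegree D₀ := by
  induction hn : ∑ v, f v using Nat.strong_induction_on generalizing f D with
  | _ n ih =>
  have hD0 : ∀ v ∈ E, D v = 0 := fun v hv => by
    by_contra hne
    refine hET (hT ▸ mem_filter.2 ⟨hE, v, hv, ?_⟩)
    have := hD v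
    omega
  obtain ⟨m, -, hm⟩ := exists_max_image univ f ⟨w₀, mem_univ _⟩
  set U : Finset V := univ.filter fun v => f v = f m with hUdef
  have hU : ∀ v, v ∈ U ↔ (f v : ℤ) = f m := fun v => by simp [hUdef]
  have hM : ∀ v, (f v : ℤ) ≤ f m := fun v => by exact_mod_cast hm v (mem_univ v)
  set D₁ := D - (G.lapMatrix ℤ).mulVec (fun w => if w ∈ U then 1 else 0) with hD₁def
  have hD₁ : IsEffective D₁ := isEffective_fire_max hD hM hf hU
  have hequiv₁ : LapEquiv G D₀ D₁ := hequiv.sub_script _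
  -- a vertex at which the script is maximal gains no chips in the end
  have hw₀U : w₀ ∉ U := fun hw => by
    rw [Pi.sub_apply, hD0 w₀ hw₀, lapMatrix_mulVec_apply_sub] at hpos
    have : 0 ≤ ∑ u ∈ G.neighborFinset w₀, ((f w₀ : ℤ) - f u) := sum_nonneg fun u _ => by
      have := (hU w₀).1 hw
      have := hM u
      omega
    omega
  have hEU : E ⊆ Uᶜ := by
    refine (S.connected E hE).subset_of_no_boundary hw₀ (mem_compl.2 hw₀U) ?_
    intro u hu w hw huU hwU hadj
    have hwU' : w ∈ U := by simpa using hwU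
    have h1 := hD₁ w
    rw [hD₁def, Pi.sub_apply, lapMatrix_mulVec_indicator_of_mem hwU', hD0 w hw] at h1
    have h2 : 0 < #(G.neighborFinset w \ U) :=
      card_pos.2 ⟨u, mem_sdiff.2 ⟨by simpa using hadj.symm, mem_compl.1 huU⟩⟩
    omega
  by_cases hsub : T ⊆ S.hitEggs D₁
  · -- nothing is vacated: `D₁` is again maximal, and the remaining script is smaller
    have hT₁ : S.hitEggs D₁ = T := (hmax D₁ hD₁ hequiv₁ hsub).antisymm hsub
    have hm0 : 0 < f m := by
      have h1 := hm w₀ (mem_univ _)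
      have h2 : f w₀ ≠ f m := fun h => hw₀U (by simp [hUdef, h])
      omega
    let g : V → ℕ := fun v => if v ∈ U then f v - 1 else f v
    have hle : ∀ v ∈ univ, g v ≤ f v := fun v _ => by
      simp only [g]
      split_ifs <;> omega
    have hlt : ∑ v, g v < n := by
      rw [← hn]
      refine sum_lt_sum hle ⟨m, mem_univ m, ?_⟩
      have : m ∈ U := by simp [hUdef]
      simp only [g, if_pos this]
      omega
    have hscript : D₁ - (G.lapMatrix ℤ).mulVec (fun v => (g v : ℤ))
        = D - (G.lapMatrix ℤ).mulVec (fun v => (f v : ℤ)) := by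
      rw [hD₁def, sub_sub, ← Matrix.mulVec_add]
      congr 2
      ext v
      by_cases hv : v ∈ U
      · have := (hU v).1 hv
        simp only [Pi.add_apply, g, if_pos hv]
        omega
      · simp [g, hv]
    exact ih _ hlt g D₁ hD₁ hequiv₁ hT₁ (hscript ▸ hf) (by rw [hscript]; exact hpos) rfl
  · obtain ⟨E', hE'T, hE'⟩ := not_subset.1 hsub
    obtain ⟨hE'S, w₁, hw₁, hw₁pos⟩ := mem_filter.1 (hT ▸ hE'T : E' ∈ S.hitEggs D)
    have hD₁0 : ∀ v ∈ E', D₁ v = 0 := fun v hv => by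
      by_contra hne
      refine hE' (mem_filter.2 ⟨hE'S, v, hv, ?_⟩)
      have := hD₁ v
      omega
    have hw₁U : w₁ ∈ U := by
      by_contra h
      have := hD₁0 w₁ hw₁
      rw [hD₁def, Pi.sub_apply, lapMatrix_mulVec_indicator_of_notMem h] at this
      omega
    have hE'U : E' ⊆ U := by
      refine (S.connected E' hE'S).subset_of_no_boundary hw₁ hw₁U ?_
      intro u hu w hw huU hwU hadj
      have h1 := hD₁0 w hw
      rw [hD₁def, Pi.sub_apply, lapMatrix_mulVec_indicator_of_notMem hwU] at h1
      have h2 : 0 < #(G.neighborFinset w ∩ U) :=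
        card_pos.2 ⟨u, mem_inter.2 ⟨by simpa using hadj.symm, huU⟩⟩
      have h3 := hD w
      omega
    exact ⟨U, ⟨⟨E', hE'S, hE'U⟩, E, hE, hEU⟩,
      hequiv.degree_eq ▸ outdegree_le_degree hD hD₁⟩

theorem Scramble.order_le_of_rank_pos [Nonempty V] (S : Scramble G) {D₀ : V → ℤ} {d : ℕ}
    (hdeg : divisorDegree D₀ = d) (hrank : 0 < rank G D₀) : S.order ≤ d := by
  obtain ⟨v₀⟩ := ‹Nonempty V›
  obtain ⟨D₁, hD₁, hequiv₁, -⟩ := exists_pos_of_rank_pos hrank v₀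
  obtain ⟨T, ⟨D, hD, hequiv, hT⟩, hTmax⟩ := Set.Finite.exists_maximal
    (Set.toFinite {T | ∃ D, IsEffective D ∧ LapEquiv G D₀ D ∧ S.hitEggs D = T})
    ⟨_, D₁, hD₁, hequiv₁, rfl⟩
  by_cases hall : ∀ E ∈ S.eggs, E ∈ T
  · -- the support of `D` is a hitting set
    refine (min_le_left _ _).trans ?_
    refine (iInf₂_le (univ.filter fun v => 0 < D v) fun E hE => ?_).trans ?_
    · obtain ⟨-, v, hv, hpos⟩ := mem_filter.1 (hT ▸ hall E hE : E ∈ S.hitEggs D)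
      exact ⟨v, mem_inter.2 ⟨by simpa using hpos, hv⟩⟩
    · have h1 : (#(univ.filter fun v => 0 < D v) : ℤ) ≤ divisorDegree D := by
        rw [card_filter, divisorDegree]
        push_cast
        refine sum_le_sum fun v _ => ?_
        have := hD v
        split_ifs <;> omega
      rw [hequiv.degree_eq, hdeg] at h1
      exact_mod_cast h1
  · push Not at hall
    obtain ⟨E, hE, hET⟩ := hall
    obtain ⟨w₀, hw₀⟩ : E.Nonempty := by
      obtain ⟨x, hx⟩ := (S.connected E hE).nonempty
      exact ⟨x, hx⟩
    obtain ⟨D'', hD'', hequiv'', hpos⟩ := exists_pos_of_rank_pos hrank w₀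
    obtain ⟨f, rfl⟩ := hequiv.exists_nat_script hequiv''
    obtain ⟨U, hU, hle⟩ := exists_eggCut_of_maximal S T
      (fun D' h1 h2 h3 => hTmax ⟨D', h1, h2, rfl⟩ h3) hE hET f D hD hequiv hT hD'' hw₀ hpos
    refine (min_le_right _ _).trans ((iInf₂_le U hU).trans ?_)
    rw [hdeg] at hle
    exact_mod_cast hle

end ScrambleGonality

/-! ### Sets whose components have at most two vertices -/

section ComponentIndependent

theorem isComponentIndependent_two_iff {G : SimpleGraph V} {S : Finset V} :
    IsComponentIndependent G 2 S ↔
      ∀ a ∈ S, ∀ b ∈ S, ∀ c ∈ S, G.Adj b a → G.Adj b c → a = c := by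
  constructor
  · intro h a ha b hb c hc hba hbc
    by_contra hac
    have hba' : (G.induce (S : Set V)).Adj ⟨b, hb⟩ ⟨a, ha⟩ := hba
    have hbc' : (G.induce (S : Set V)).Adj ⟨b, hb⟩ ⟨c, hc⟩ := hbc
    have hle := h ((G.induce (S : Set V)).connectedComponentMk ⟨b, hb⟩)
    have hsub : ({⟨a, ha⟩, ⟨b, hb⟩, ⟨c, hc⟩} : Set (S : Set V)) ⊆
        ((G.induce (S : Set V)).connectedComponentMk ⟨b, hb⟩).supp := by
      rintro x (rfl | rfl | rfl)
      · exact SimpleGraph.ConnectedComponent.sound hba'.symm.reachable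
      · rfl
      · exact SimpleGraph.ConnectedComponent.sound hbc'.symm.reachable
    have h3 := Set.ncard_le_ncard hsub (Set.toFinite _)
    rw [Set.ncard_eq_three.2 ⟨_, _, _, by simpa using hba.ne', by simpa using hac,
      by simpa using hbc.ne, rfl⟩] at h3
    omega
  · intro h c
    induction c using SimpleGraph.ConnectedComponent.ind with
    | _ x =>
    -- a walk from `x` cannot get further than the neighbours of `x`
    have hreach : ∀ y, (G.induce (S : Set V)).Reachable x y →
        y = x ∨ (G.induce (S : Set V)).Adj x y := by
      rintro y ⟨p⟩
      by_contra hy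
      obtain ⟨d, -, h1, h2⟩ := p.exists_boundary_dart
        {z | z = x ∨ (G.induce (S : Set V)).Adj x z} (Or.inl rfl) hy
      simp only [Set.mem_ofPred_eq, not_or] at h1 h2
      have hadj : (G.induce (S : Set V)).Adj d.fst d.snd := d.adj
      rcases h1 with h1 | h1
      · exact h2.2 (h1 ▸ hadj)
      · exact h2.1 (Subtype.ext (h _ d.snd.2 _ d.fst.2 _ x.2 hadj h1.symm))
    by_cases hx : ∃ y, (G.induce (S : Set V)).Adj x y
    · obtain ⟨y, hy⟩ := hx
      refine (Set.ncard_le_ncard (t := {x, y}) ?_ (Set.toFinite _)).trans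
        ((Set.ncard_insert_le _ _).trans (by simp))
      intro z hz
      rcases hreach z (SimpleGraph.ConnectedComponent.exact hz).symm with rfl | hz
      · simp
      · exact Or.inr (Subtype.ext (h _ z.2 _ x.2 _ y.2 hz hy))
    · refine (Set.ncard_le_ncard (t := {x}) ?_ (Set.toFinite _)).trans (by simp)
      intro z hz
      rcases hreach z (SimpleGraph.ConnectedComponent.exact hz).symm with rfl | hz
      · simp
      · exact absurd ⟨z, hz⟩ hx

theorem IsComponentIndependent.card_le {V : Type*} [Fintype V] {G : SimpleGraph V} {l : ℕ}
    {S : Finset V}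
    (h : IsComponentIndependent G l S) : #S ≤ componentIndepNum G l := by
  classical
  exact le_sup (f := Finset.card) (by simpa using h)

theorem exists_isComponentIndependent_card_eq (G : SimpleGraph V) :
    ∃ S, IsComponentIndependent G 2 S ∧ #S = componentIndepNum G 2 := by
  classical
  obtain ⟨S, hS, h⟩ := exists_mem_eq_sup
    ({S : Finset V | IsComponentIndependent G 2 S} : Finset (Finset V))
    ⟨∅, by simp [isComponentIndependent_two_iff]⟩ Finset.card
  exact ⟨S, by simpa using hS, by rw [componentIndepNum, h]⟩

theorem degree_le_componentIndepNum {G : SimpleGraph V} [DecidableRel G.Adj]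
    (htri : ∀ a b c, G.Adj a b → G.Adj b c → ¬ G.Adj a c) (v : V) :
    G.degree v ≤ componentIndepNum G 2 := by
  rw [← SimpleGraph.card_neighborFinset_eq_degree]
  refine (isComponentIndependent_two_iff.2 ?_).card_le
  intro a ha b hb _ _ hba _
  rw [SimpleGraph.mem_neighborFinset] at ha hb
  exact absurd ha (htri _ _ _ hb hba)

end ComponentIndependent

/-! ### The upper bound for the gonality -/

/-- If `S` has components of at most two vertices, one chip on each vertex outside `S` is a
divisor of positive rank: to reach `v ∈ S`, fire the complement of its component in `G[S]`. As `G`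
has no triangles, no vertex outside the component has two neighbours in it. -/
theorem rank_indicator_compl_pos [Nonempty V] {G : SimpleGraph V} [DecidableRel G.Adj]
    (htri : ∀ a b c, G.Adj a b → G.Adj b c → ¬ G.Adj a c) (hdeg : ∀ v, 3 ≤ G.degree v)
    {S : Finset V} (hS : IsComponentIndependent G 2 S) :
    0 < rank G (fun v => if v ∈ S then 0 else 1) := by
  rw [isComponentIndependent_two_iff] at hS
  have heff : IsEffective (fun v => if v ∈ S then (0 : ℤ) else 1) := fun v => by
    dsimp only
    split_ifs <;> simp
  refine rank_pos_of_exists_pos heff fun v => ?_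
  by_cases hv : v ∈ S
  · set C : Finset V := insert v (G.neighborFinset v ∩ S) with hC
    have hCS : C ⊆ S := insert_subset hv inter_subset_right
    have hsub : ∀ a ∈ G.neighborFinset v ∩ S, ∀ b ∈ G.neighborFinset v ∩ S, a = b := by
      intro a ha b hb
      rw [mem_inter, SimpleGraph.mem_neighborFinset] at ha hb
      exact hS a ha.2 v hv b hb.2 ha.1 hb.1
    have hone : ∀ w, #(G.neighborFinset w ∩ C) ≤ 1 := by
      intro w
      refine card_le_one.2 fun a ha b hb => ?_
      rw [mem_inter, SimpleGraph.mem_neighborFinset, hC, mem_insert] at ha hb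
      obtain ⟨hwa, rfl | ha⟩ := ha <;> obtain ⟨hwb, rfl | hb⟩ := hb
      · rfl
      · exact absurd hwb (htri w _ b hwa (by simpa using (mem_inter.1 hb).1))
      · exact absurd hwa (htri w _ a hwb (by simpa using (mem_inter.1 ha).1))
      · exact hsub a ha b hb
    -- firing the complement of `C` has the effect of the script `-1` on `C`
    set f : V → ℤ := -(fun w => if w ∈ C then 1 else 0) with hf
    have hin : ∀ w ∈ C, 0 < ((fun v => if v ∈ S then (0 : ℤ) else 1)
        - (G.lapMatrix ℤ).mulVec f) w := by
      intro w hw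
      have h1 := card_sdiff_add_card_inter (G.neighborFinset w) C
      rw [SimpleGraph.card_neighborFinset_eq_degree] at h1
      have h2 := hone w
      have h3 := hdeg w
      rw [hf, Matrix.mulVec_neg, Pi.sub_apply, Pi.neg_apply,
        lapMatrix_mulVec_indicator_of_mem hw, if_pos (hCS hw)]
      omega
    refine ⟨_, fun w => ?_, ⟨f, rfl⟩, hin v (mem_insert_self _ _)⟩
    by_cases hw : w ∈ C
    · exact (hin w hw).le
    · rw [hf, Matrix.mulVec_neg, Pi.sub_apply, Pi.neg_apply,
        lapMatrix_mulVec_indicator_of_notMem hw]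
      by_cases hwS : w ∈ S
      · have : G.neighborFinset w ∩ C = ∅ := by
          refine eq_empty_of_forall_notMem fun a ha => hw ?_
          rw [mem_inter, SimpleGraph.mem_neighborFinset, hC, mem_insert] at ha
          obtain ⟨hwa, rfl | ha⟩ := ha
          · exact mem_insert_of_mem (by simp [hwS, hwa.symm])
          · rw [mem_inter, SimpleGraph.mem_neighborFinset] at ha
            rw [hS w hwS a ha.2 v hv hwa.symm ha.1.symm]
            exact mem_insert_self _ _
        simp [this, hwS]
      · have := hone w
        simp only [hwS, if_false]
        omega
  · exact ⟨_, heff, ⟨0, by simp⟩, by simp [hv]⟩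

/-! ### Small edge cuts -/

section EdgeCut

theorem card_mul_le_two_mul_sum {ι : Type*} [DecidableEq ι] {s : Finset ι} (hs : 2 ≤ #s)
    {f : ι → ℤ} {T : ℤ} (h : ∀ x ∈ s, ∀ y ∈ s, x ≠ y → T ≤ f x + f y) :
    #s * T ≤ 2 * ∑ x ∈ s, f x := by
  have h1 : ∀ x ∈ s, ((#s : ℤ) - 1) * T ≤ ((#s : ℤ) - 2) * f x + ∑ y ∈ s, f y := by
    intro x hx
    have h2 := card_nsmul_le_sum (s.erase x) (fun y => f x + f y) T
      fun y hy => h x hx y (mem_of_mem_erase hy) (ne_of_mem_erase hy).symm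
    have h3 := add_sum_erase s f hx
    rw [sum_add_distrib, sum_const, card_erase_of_mem hx, nsmul_eq_mul, nsmul_eq_mul,
      Nat.cast_sub (by omega)] at h2
    push_cast at h2
    linarith
  have h4 := sum_le_sum h1
  rw [sum_const, sum_add_distrib, ← mul_sum, sum_const, nsmul_eq_mul, nsmul_eq_mul] at h4
  have h5 : (0 : ℤ) < (#s : ℤ) - 1 := by
    have : (2 : ℤ) ≤ #s := by exact_mod_cast hs
    linarith
  refine le_of_mul_le_mul_left ?_ h5
  linarith

variable {G : SimpleGraph V} [DecidableRel G.Adj]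

theorem degree_add_degree_le_card (htri : ∀ a b c, G.Adj a b → G.Adj b c → ¬ G.Adj a c)
    {A : Finset V} {u v : V} (h : G.Adj u v) :
    #(G.neighborFinset u ∩ A) + #(G.neighborFinset v ∩ A) ≤ #A := by
  rw [← card_union_of_disjoint]
  · exact card_le_card (union_subset inter_subset_right inter_subset_right)
  · refine disjoint_left.2 fun w hu hv => ?_
    rw [mem_inter, SimpleGraph.mem_neighborFinset] at hu hv
    exact htri u v w h hv.1 hu.1

/-- The two edges of the path account for four in the degree sum of its vertices. -/
theorem outdegree_path_add_four_le {a b c : V} (hab : G.Adj a b) (hbc : G.Adj b c) (hac : a ≠ c) :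
    outdegree G {a, b, c} + 4 ≤ G.degree a + G.degree b + G.degree c := by
  have hsplit : ∀ x, #(G.neighborFinset x \ {a, b, c}) + #(G.neighborFinset x ∩ {a, b, c})
      = G.degree x := fun x => by
    rw [card_sdiff_add_card_inter, SimpleGraph.card_neighborFinset_eq_degree]
  have ha : 0 < #(G.neighborFinset a ∩ {a, b, c}) :=
    card_pos.2 ⟨b, by simp [hab]⟩
  have hc : 0 < #(G.neighborFinset c ∩ {a, b, c}) :=
    card_pos.2 ⟨b, by simp [hbc.symm]⟩
  have hb : 1 < #(G.neighborFinset b ∩ {a, b, c}) :=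
    one_lt_card.2 ⟨a, by simp [hab.symm], c, by simp [hbc], hac⟩
  have h1 := hsplit a
  have h2 := hsplit b
  have h3 := hsplit c
  rw [outdegree_eq_sum, sum_insert (by simp [hab.ne, hac]), sum_insert (by simp [hbc.ne]),
    sum_singleton]
  omega

/-- If every vertex of `A` has two neighbours outside `A`, then `A` sends out as many edges as any
connected three-set `P` inside it: an edge from `P` to `A \ P` is paid for at its end in
`A \ P`, which has at most two neighbours in `P`. -/
theorem outdegree_le_of_two_le (htri : ∀ a b c, G.Adj a b → G.Adj b c → ¬ G.Adj a c)
    {A P : Finset V} (hP : IsConnectedSet G P) (hP3 : #P = 3) (hPA : P ⊆ A)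
    (h : ∀ x ∈ A, 2 ≤ #(G.neighborFinset x \ A)) : outdegree G P ≤ outdegree G A := by
  have hcount : ∀ x, #(G.neighborFinset x ∩ P) ≤ 2 := by
    intro x
    obtain ⟨u, hu, w, hw, huw⟩ := hP.exists_adj (by omega)
    have hne : G.neighborFinset x ∩ P ≠ P := by
      intro heq
      have h1 : u ∈ G.neighborFinset x ∩ P := by rw [heq]; exact hu
      have h2 : w ∈ G.neighborFinset x ∩ P := by rw [heq]; exact hw
      rw [mem_inter, SimpleGraph.mem_neighborFinset] at h1 h2
      exact htri x u w h1.1 huw h2.1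
    have := card_lt_card (inter_subset_right.ssubset_of_ne hne)
    omega
  have hswap : ∑ x ∈ P, #(G.neighborFinset x ∩ (A \ P))
      = ∑ x ∈ A \ P, #(G.neighborFinset x ∩ P) := by
    have h1 := sum_card_bipartiteAbove_eq_sum_card_bipartiteBelow (s := P) (t := A \ P) G.Adj
    refine (sum_congr rfl fun x _ => ?_).trans (h1.trans (sum_congr rfl fun x _ => ?_))
    · congr 1
      ext y
      simp [bipartiteAbove, and_comm]
    · congr 1
      ext y
      simp [bipartiteBelow, and_comm, G.adj_comm]
  have hPsplit : ∀ x, #(G.neighborFinset x \ P)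
      ≤ #(G.neighborFinset x \ A) + #(G.neighborFinset x ∩ (A \ P)) := fun x => by
    refine (card_le_card fun y hy => ?_).trans (card_union_le _ _)
    simp only [mem_sdiff, mem_union, mem_inter] at hy ⊢
    tauto
  rw [outdegree_eq_sum, outdegree_eq_sum, ← sum_sdiff hPA]
  calc ∑ x ∈ P, #(G.neighborFinset x \ P)
      ≤ ∑ x ∈ P, #(G.neighborFinset x \ A) + ∑ x ∈ P, #(G.neighborFinset x ∩ (A \ P)) := by
        rw [← sum_add_distrib]
        exact sum_le_sum fun x _ => hPsplit x
    _ ≤ ∑ x ∈ P, #(G.neighborFinset x \ A) + ∑ x ∈ A \ P, #(G.neighborFinset x \ A) := by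
        rw [hswap]
        exact Nat.add_le_add_left (sum_le_sum fun x hx =>
          (hcount x).trans (h x (mem_sdiff.1 hx).1)) _
    _ = _ := add_comm _ _

/-- In a set `A` of at most half the vertices, two neighbours `z`, `z'` of `y` in `A` have few
neighbours in `A`, as these avoid the neighbours of `y`; by the degree condition on paths
`z - y - z'` they then send many edges out of `A`. -/
theorem card_mul_le_two_mul_outdegree
    (htri : ∀ a b c, G.Adj a b → G.Adj b c → ¬ G.Adj a c)
    (hpath : ∀ a b c, G.Adj a b → G.Adj b c → a ≠ c →
      Fintype.card V + 5 ≤ G.degree a + G.degree b + G.degree c)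
    {A : Finset V} (hA : 2 * #A ≤ Fintype.card V) {y : V} (hy : y ∈ A) {m c : ℤ}
    (hm : (#(G.neighborFinset y ∩ A) : ℤ) = m) (hc : (#(G.neighborFinset y \ A) : ℤ) = c)
    (hm2 : 2 ≤ m) :
    m * (5 + m - c) + 2 * c ≤ 2 * (outdegree G A : ℤ) := by
  have hsplit : ∀ x, #(G.neighborFinset x \ A) + #(G.neighborFinset x ∩ A) = G.degree x :=
    fun x => by rw [card_sdiff_add_card_inter, SimpleGraph.card_neighborFinset_eq_degree]
  have hpair := card_mul_le_two_mul_sum (s := G.neighborFinset y ∩ A)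
    (f := fun z => (#(G.neighborFinset z \ A) : ℤ)) (T := 5 + m - c) (by omega) (by
      intro z hz z' hz' hne
      rw [mem_inter, SimpleGraph.mem_neighborFinset] at hz hz'
      have h1 := hpath z y z' hz.1.symm hz'.1 hne
      have h2 := degree_add_degree_le_card htri (A := A) hz.1
      have h3 := degree_add_degree_le_card htri (A := A) hz'.1
      have h4 := hsplit y
      have h5 := hsplit z
      have h6 := hsplit z'
      omega)
  have hsum : (∑ z ∈ G.neighborFinset y ∩ A, (#(G.neighborFinset z \ A) : ℤ)) + c
      ≤ outdegree G A := by
    rw [outdegree_eq_sum, ← add_sum_erase A _ hy, ← hc, add_comm]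
    push_cast
    refine add_le_add_right (sum_le_sum_of_subset_of_nonneg (fun z hz => ?_)
      fun _ _ _ => by positivity) _
    rw [mem_inter, SimpleGraph.mem_neighborFinset] at hz
    exact mem_erase.2 ⟨hz.1.ne', hz.2⟩
  rw [hm] at hpair
  linarith

end EdgeCut

/-! ### The scramble of connected three-sets -/

section ScrambleLowerBound

variable {G : SimpleGraph V} [DecidableRel G.Adj]

theorem card_add_five_le_degree_sum (hxi : (Fintype.card V : ℕ∞) + 1 ≤ xi G 3) {a b c : V}
    (hab : G.Adj a b) (hbc : G.Adj b c) (hac : a ≠ c) :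
    Fintype.card V + 5 ≤ G.degree a + G.degree b + G.degree c := by
  have h1 : (Fintype.card V : ℕ∞) + 1 ≤ outdegree G {a, b, c} :=
    hxi.trans (iInf₂_le _ ⟨isConnectedSet_path hab hbc,
      card_eq_three.2 ⟨a, b, c, hab.ne, hac, hbc.ne, rfl⟩⟩)
  have h2 : Fintype.card V + 1 ≤ outdegree G {a, b, c} := by exact_mod_cast h1
  have h3 := outdegree_path_add_four_le hab hbc hac
  omega

theorem exists_adj_ne {V : Type*} [Fintype V] {G : SimpleGraph V} [DecidableRel G.Adj]
    (hdeg : ∀ v, 3 ≤ G.degree v) (u w : V) : ∃ v, G.Adj u v ∧ v ≠ w := by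
  have h1 : 1 < #(G.neighborFinset u) := by
    rw [SimpleGraph.card_neighborFinset_eq_degree]
    have := hdeg u
    omega
  obtain ⟨v, hv, hne⟩ := exists_mem_ne h1 w
  exact ⟨v, by simpa using hv, hne⟩

theorem five_le_degree (htri : ∀ a b c, G.Adj a b → G.Adj b c → ¬ G.Adj a c)
    (hdeg : ∀ v, 3 ≤ G.degree v) (hxi : (Fintype.card V : ℕ∞) + 1 ≤ xi G 3) (w : V) :
    5 ≤ G.degree w := by
  obtain ⟨u, hwu, -⟩ := exists_adj_ne hdeg w w
  obtain ⟨v, huv, hvw⟩ := exists_adj_ne hdeg u w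
  have h1 := card_add_five_le_degree_sum hxi hwu huv hvw.symm
  have h2 := degree_add_degree_le_card htri (A := univ) huv
  simp only [inter_univ, SimpleGraph.card_neighborFinset_eq_degree, card_univ] at h2
  omega

/-- A set of at most half the vertices that contains a connected three-set sends out at least
`n - α` edges, where `α` is the largest size of a set with components of at most two vertices.
Only `α ≥ Δ` is used: if there are fewer edges, then fewer than `n - Δ`. Then some `x ∈ A` has
at most one neighbour outside `A`. Counting the edges leaving `A` at the neighbours of `x` shows
that `x` has small degree, so its neighbours have large degree, mostly inside `A`; counting
again at the neighbours of such a neighbour gives too many edges. -/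
theorem card_le_outdegree_add_componentIndepNum
    (htri : ∀ a b c, G.Adj a b → G.Adj b c → ¬ G.Adj a c)
    (hdeg : ∀ v, 3 ≤ G.degree v) (hxi : (Fintype.card V : ℕ∞) + 1 ≤ xi G 3)
    {A P : Finset V} (hP : IsConnectedSet G P) (hP3 : #P = 3) (hPA : P ⊆ A)
    (hA : 2 * #A ≤ Fintype.card V) :
    Fintype.card V ≤ outdegree G A + componentIndepNum G 2 := by
  by_contra! hlt
  set n := Fintype.card V
  have hpath := fun a b c => card_add_five_le_degree_sum (G := G) hxi (a := a) (b := b) (c := c)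
  have hα := degree_le_componentIndepNum htri
  have hsplit : ∀ x, #(G.neighborFinset x \ A) + #(G.neighborFinset x ∩ A) = G.degree x :=
    fun x => by rw [card_sdiff_add_card_inter, SimpleGraph.card_neighborFinset_eq_degree]
  obtain ⟨x, hxA, hx⟩ : ∃ x ∈ A, #(G.neighborFinset x \ A) ≤ 1 := by
    by_contra! hcon
    have h1 := outdegree_le_of_two_le htri hP hP3 hPA hcon
    have h2 : (n : ℕ∞) + 1 ≤ outdegree G P := hxi.trans (iInf₂_le _ ⟨hP, hP3⟩)
    have h3 : n + 1 ≤ outdegree G P := by exact_mod_cast h2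
    omega
  have hx5 := five_le_degree htri hdeg hxi x
  have hxs := hsplit x
  have hxcount := card_mul_le_two_mul_outdegree htri hpath hA hxA rfl rfl (by omega)
  have hxpair : ∀ y ∈ G.neighborFinset x ∩ A, ∀ z ∈ G.neighborFinset x ∩ A, y ≠ z →
      n + 5 ≤ G.degree y + G.degree x + G.degree z := fun y hy z hz hne => by
    rw [mem_inter, SimpleGraph.mem_neighborFinset] at hy hz
    exact hpath y x z hy.1.symm hz.1 hne
  have hk4 : 4 ≤ #(G.neighborFinset x ∩ A) := by omega
  -- `2Δ ≥ n + 4 - k`, since two neighbours of `x` lie on a path through `x`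
  have hcut : 2 * outdegree G A + 6 ≤ n + #(G.neighborFinset x ∩ A) := by
    obtain ⟨y, hy, z, hz, hne⟩ := one_lt_card.1 (show 1 < #(G.neighborFinset x ∩ A) by omega)
    have h1 := hxpair y hy z hz hne
    have h2 := hα y
    have h3 := hα z
    omega
  -- so `k (k + 3) ≤ n - 6`, where `k ≥ 4`
  have hk7 : 7 * #(G.neighborFinset x ∩ A) + 6 ≤ n := by
    zify at hk4 hcut hx ⊢
    have h1 := mul_nonneg (Int.natCast_nonneg #(G.neighborFinset x ∩ A)) (sub_nonneg.2 hx)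
    have h2 := mul_nonneg (Int.natCast_nonneg #(G.neighborFinset x ∩ A)) (sub_nonneg.2 hk4)
    linarith
  -- some two neighbours of `x` in `A` send few edges out of `A`
  obtain ⟨y, hy, z, hz, hne, hyz⟩ : ∃ y ∈ G.neighborFinset x ∩ A, ∃ z ∈ G.neighborFinset x ∩ A,
      y ≠ z ∧ 4 * (#(G.neighborFinset y \ A) + #(G.neighborFinset z \ A)) ≤ n := by
    by_contra! hcon
    have h1 := card_mul_le_two_mul_sum (s := G.neighborFinset x ∩ A) (by omega)
      (f := fun z => 4 * (#(G.neighborFinset z \ A) : ℤ)) (T := n + 1) (by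
        intro y hy z hz hne
        have := hcon y hy z hz hne
        omega)
    have h2 : (∑ z ∈ G.neighborFinset x ∩ A, (#(G.neighborFinset z \ A) : ℤ))
        ≤ outdegree G A := by
      rw [outdegree_eq_sum]
      push_cast
      exact sum_le_sum_of_subset_of_nonneg inter_subset_right fun _ _ _ => by positivity
    rw [← mul_sum] at h1
    zify at hcut hk4 hk7
    have h3 : (0 : ℤ) ≤ n - 3 := by linarith
    have h4 := mul_nonneg (sub_nonneg.2 hk4) h3
    linarith
  wlog hmax : #(G.neighborFinset z ∩ A) ≤ #(G.neighborFinset y ∩ A) generalizing y z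
  · exact this z hz y hy hne.symm (by rwa [add_comm]) (by omega)
  have hyz5 := hxpair y hy z hz hne
  have hys := hsplit y
  have hzs := hsplit z
  have hm : 2 * n + 17 ≤ 7 * #(G.neighborFinset y ∩ A) := by omega
  have hycount := card_mul_le_two_mul_outdegree htri hpath hA (mem_inter.1 hy).2 rfl rfl
    (by omega)
  have hαy := hα y
  have hcm : #(G.neighborFinset y \ A) ≤ #(G.neighborFinset y ∩ A) := by omega
  zify at hm hcm hlt hαy hys
  have h1 := mul_nonneg (Int.natCast_nonneg #(G.neighborFinset y ∩ A)) (sub_nonneg.2 hcm)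
  linarith

/-- The scramble whose eggs are the connected sets of three vertices. -/
noncomputable def threeScramble {V : Type*} [Fintype V] (G : SimpleGraph V) : Scramble G where
  eggs := by
    classical exact univ.filter fun P => IsConnectedSet G P ∧ #P = 3
  connected := fun _ hE => (by simpa using hE : _ ∧ _).1

theorem mem_threeScramble_eggs {V : Type*} [Fintype V] {G : SimpleGraph V} {P : Finset V} :
    P ∈ (threeScramble G).eggs ↔ IsConnectedSet G P ∧ #P = 3 := by
  simp [threeScramble]

/-- A set meets every connected three-set exactly when its complement has components of at most
two vertices. -/
theorem le_hittingNumber_threeScramble (G : SimpleGraph V) :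
    ((Fintype.card V - componentIndepNum G 2 : ℕ) : ℕ∞) ≤ (threeScramble G).hittingNumber := by
  refine le_iInf₂ fun C hC => ?_
  have hind : IsComponentIndependent G 2 Cᶜ := by
    refine isComponentIndependent_two_iff.2 fun a ha b hb c hc hba hbc => ?_
    by_contra hac
    obtain ⟨v, hv⟩ := hC {a, b, c} (mem_threeScramble_eggs.2
      ⟨isConnectedSet_path hba.symm hbc, card_eq_three.2 ⟨a, b, c, hba.ne', hac, hbc.ne, rfl⟩⟩)
    rw [mem_compl] at ha hb hc
    rw [mem_inter, mem_insert, mem_insert, mem_singleton] at hv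
    obtain ⟨hv, rfl | rfl | rfl⟩ := hv <;> contradiction
  have h1 := hind.card_le
  have h2 := card_add_card_compl C
  exact_mod_cast (by omega : Fintype.card V - componentIndepNum G 2 ≤ #C)

theorem le_eggCutNumber_threeScramble
    (htri : ∀ a b c, G.Adj a b → G.Adj b c → ¬ G.Adj a c)
    (hdeg : ∀ v, 3 ≤ G.degree v) (hxi : (Fintype.card V : ℕ∞) + 1 ≤ xi G 3) :
    ((Fintype.card V - componentIndepNum G 2 : ℕ) : ℕ∞) ≤ (threeScramble G).eggCutNumber := by
  refine le_iInf₂ fun A hA => ?_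
  obtain ⟨⟨P, hP, hPA⟩, Q, hQ, hQA⟩ := hA
  rw [mem_threeScramble_eggs] at hP hQ
  have hcard := card_add_card_compl A
  have : Fintype.card V ≤ outdegree G A + componentIndepNum G 2 := by
    rcases le_total (#A) (#Aᶜ) with h | h
    · exact card_le_outdegree_add_componentIndepNum htri hdeg hxi hP.1 hP.2 hPA (by omega)
    · rw [← outdegree_compl]
      exact card_le_outdegree_add_componentIndepNum htri hdeg hxi hQ.1 hQ.2 hQA (by omega)
  exact_mod_cast (by omega : Fintype.card V - componentIndepNum G 2 ≤ outdegree G A)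

end ScrambleLowerBound

end GraphGonality

theorem mainTheorem4 {V : Type*} [Fintype V] [DecidableEq V] (G : SimpleGraph V)
    [DecidableRel G.Adj] (hconn : G.Connected) (htri : G.CliqueFree 3)
    (hdeg : 3 ≤ G.minDegree)
    (hxi : (Fintype.card V : ℕ∞) + 1 ≤ GraphGonality.xi G 3) :
    GraphGonality.scrambleNumber G = (GraphGonality.gonality G : ℕ∞) ∧
      (GraphGonality.gonality G : ℤ) =
        (Fintype.card V : ℤ) - (GraphGonality.componentIndepNum G 2 : ℤ) := by
  open GraphGonality in
  have hne : Nonempty V := hconn.nonempty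
  have htri' : ∀ a b c, G.Adj a b → G.Adj b c → ¬ G.Adj a c := fun a b c hab hbc hac =>
    htri {a, b, c} (SimpleGraph.is3Clique_triple_iff.2 ⟨hab, hac, hbc⟩)
  have hdeg' : ∀ v, 3 ≤ G.degree v := fun v => hdeg.trans (G.minDegree_le_degree v)
  obtain ⟨S, hS, hScard⟩ := exists_isComponentIndependent_card_eq G
  have hle : componentIndepNum G 2 ≤ Fintype.card V := hScard ▸ S.card_le_univ
  have hmem : Fintype.card V - componentIndepNum G 2 ∈
      {d : ℕ | ∃ D : V → ℤ, divisorDegree D = d ∧ 0 < rank G D} := by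
    refine ⟨_, ?_, rank_indicator_compl_pos htri' hdeg' hS⟩
    have h1 : divisorDegree (fun v => if v ∈ S then (0 : ℤ) else 1) = (Sᶜ.card : ℤ) := by
      rw [divisorDegree, Finset.compl_eq_univ_sdiff, ← Finset.filter_notMem_eq_sdiff,
        Finset.card_filter]
      push_cast
      exact Finset.sum_congr rfl fun v _ => by split_ifs <;> simp_all
    rw [h1, Finset.card_compl, hScard]
  have hupper : gonality G ≤ Fintype.card V - componentIndepNum G 2 := Nat.sInf_le hmem
  have hsn : scrambleNumber G ≤ gonality G := by
    obtain ⟨D, hD, hrank⟩ := Nat.sInf_mem ⟨_, hmem⟩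
    exact iSup_le fun T => T.order_le_of_rank_pos hD hrank
  have hlower : ((Fintype.card V - componentIndepNum G 2 : ℕ) : ℕ∞) ≤ scrambleNumber G :=
    (le_min (le_hittingNumber_threeScramble G)
      (le_eggCutNumber_threeScramble htri' hdeg' hxi)).trans
        (le_iSup Scramble.order (threeScramble G))
  have hgon : gonality G = Fintype.card V - componentIndepNum G 2 :=
    hupper.antisymm (by exact_mod_cast hlower.trans hsn)
  refine ⟨hsn.antisymm ?_, by omega⟩
  rw [hgon]
  exact hlower
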